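/- Consider a fixed-gain amplify-and-forward link with $N\ge 2$ hops, channel coefficients $h_1,\dots,h_N$, fixed real gains $A_0,\dots,A_{N-1}$ and noise scaling factors $\rho_1,\dots,\rho_N>0$. Put $X_n=A_{n-1}^2|h_n|^2$ and $$\mathsf{SNR}=\frac{\prod_{n=1}^N X_n}{\sum_{n=1}^N\rho_n\prod_{j=n+1}^N X_j}\,\bar\gamma ,\qquad P_o(\bar\gamma)=P(\mathsf{SNR}<\gamma_{th}),\qquad \gamma_{th}>0 .$$ Assume that $X_1,\dots,X_N$ are independent and that $X_n$ has the Hoyt power density with parameters $q_n>0$, $\theta_n>0$, $$f_{X_n}(x)=\frac{1+q_n^2}{2q_n\theta_n}\,e^{-\frac{(1+q_n^2)^2}{4q_n^2\theta_n}x}\,I_0\!\left(\frac{1-q_n^4}{4q_n^2\theta_n}x\right),\quad x\ge 0,$$ where $I_0(x)=\sum_{k\ge0}(x/2)^{2k}/(k!)^2$. Fix integers $L_1,\dots,L_{N-1}\ge 1$. For $\boldsymbol\ell=(\ell_1,\dots,\ell_{N-1})$ with $0\le\ell_k\le L_k-1$ put $\lambda_n=\sum_{k=1}^n\ell_k$ (so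 $\lambda_0=0$). For $1\le r\le N$ let $\mathcal L_r$ be the set of those $\boldsymbol\ell$ with $\lambda_{r-1}=0$ and, if $r\le N-1$, $\lambda_r>0$. Put $$\chi_{\boldsymbol\ell}=\left(\frac{2q_N}{1+q_N^2}\right)^{1+2\lambda_{N-1}}\prod_{n=1}^{N-1}\frac{\theta_{n+1}^{\lambda_n}}{\ell_n!}\left(\frac{\rho_n}{\rho_N}\right)^{\ell_n}\left(\frac{2q_n}{1+q_n^2}\right)^{1+2\lambda_{n-1}},$$ $$\eta(s)=\eta_{r,\boldsymbol\ell}(s)=(s-1)^r\frac{\Gamma(\lambda_{N-1}-s)}{\Gamma(1-s)}\prod_{n=1}^N\Gamma(1+\lambda_{n-1}-s)\;{}_2F_1\!\left(\tfrac{1+\lambda_{n-1}-s}{2},\tfrac{2+\lambda_{n-1}-s}{2};1;\left(\tfrac{1-q_n^2}{1+q_n^2}\right)^2\right).$$ Then for all $1\le r\le N$, $\boldsymbol\ell\in\mathcal L_r$ and $0\le k<r$ the limit $\eta^{(k)}(1):=\lim_{s\to1,\,s\ne1}\eta^{(k)}(s)$ exists, and with $$B=\frac{\rho_N\gamma_{th}\prod_{n=1}^N(1+q_n^2)^2}{\prod_{n=1}^N4q_n^2\theta_n}$$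 the outage probability satisfies, as $\bar\gamma\to\infty$, $$P_o(\bar\gamma)\sim B\sum_{r=1}^N\sum_{\boldsymbol\ell\in\mathcal L_r}(-1)^{\lambda_{N-1}}\chi_{\boldsymbol\ell}\sum_{l=0}^{r-1}\frac{\eta^{(r-1-l)}(1)}{(r-1-l)!\,l!}\sum_{p=0}^l\binom lp(-1)^p(\log B)^{l-p}\,\frac{(\log\bar\gamma)^p}{\bar\gamma}$$ and, to leading order, $$P_o(\bar\gamma)\sim\frac{\rho_N\gamma_{th}}{(N-1)!}\prod_{n=1}^N\frac{1+q_n^2}{2q_n\theta_n}\;\frac{(\log\bar\gamma)^{N-1}}{\bar\gamma}.$$ Here $f\sim g$ denotes asymptotic equivalence: $f-g=o(g)$ as $\bar\gamma\to\infty$. -/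

import Mathlib

open MeasureTheory ProbabilityTheory Filter Topology Asymptotics

noncomputable section

namespace HoytRelay

/-! Throughout, `M` is the number of relays, so that the link has `N = M + 1` hops. The `n`-th hop,
`1 ≤ n ≤ N`, is the element `n - 1` of `Fin (M + 1)`; the summation index `ℓ_k`, `1 ≤ k ≤ N - 1`,
is the entry `k - 1` of a vector indexed by `Fin M`. -/

/-- The modified Bessel function of the first kind of order zero,
`I₀(x) = ∑ (x / 2) ^ (2 k) / (k!) ^ 2`. -/
def besselI0 (x : ℝ) : ℝ :=
  ∑' k : ℕ, (x / 2) ^ (2 * k) / (k.factorial : ℝ) ^ 2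

/-- The Hoyt (Nakagami-`q`) channel power density with fading parameter `q` and scale `θ`. -/
def hoytPDF (q θ x : ℝ) : ℝ :=
  if 0 ≤ x then
    (1 + q ^ 2) / (2 * q * θ) * Real.exp (-((1 + q ^ 2) ^ 2 / (4 * q ^ 2 * θ) * x)) *
      besselI0 ((1 - q ^ 4) / (4 * q ^ 2 * θ) * x)
  else 0

/-- The Hoyt channel power distribution. -/
def hoytMeasure (q θ : ℝ) : Measure ℝ :=
  volume.withDensity fun x => ENNReal.ofReal (hoytPDF q θ x)

section Link

variable {Ω : Type*} {M : ℕ}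

/-- The power `X_n = A_{n-1} ^ 2 |h_n| ^ 2` of the `n`-th hop. The entry `n - 1` of `A` is the
gain `A_{n-1}` of the transmitter of the `n`-th hop, and the entry `n - 1` of `h` is the channel
coefficient `h_n`. -/
def hopPower (A : Fin (M + 1) → ℝ) (h : Fin (M + 1) → Ω → ℂ) (n : Fin (M + 1)) (ω : Ω) : ℝ :=
  A n ^ 2 * ‖h n ω‖ ^ 2

/-- The instantaneous end-to-end signal-to-noise ratio of the fixed-gain link,
`∏ X_n / (∑ ρ_n ∏_{j > n} X_j) * γ`. -/
def snr (A ρ : Fin (M + 1) → ℝ) (h : Fin (M + 1) → Ω → ℂ) (γ : ℝ) (ω : Ω) : ℝ :=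
  (∏ n, hopPower A h n ω) / (∑ n, ρ n * ∏ j ∈ Finset.Ioi n, hopPower A h j ω) * γ

/-- The outage probability `P(SNR < γth)` at reference signal-to-noise ratio `γ`. -/
def outage [MeasurableSpace Ω] (P : Measure Ω) (A ρ : Fin (M + 1) → ℝ)
    (h : Fin (M + 1) → Ω → ℂ) (γth γ : ℝ) : ℝ :=
  P.real {ω | snr A ρ h γ ω < γth}

end Link

section Expansion

variable {M : ℕ}

/-- `lam ℓ n = λ_n = ℓ_1 + ⋯ + ℓ_n`. -/
def lam (ℓ : Fin M → ℕ) (n : ℕ) : ℕ :=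
  ∑ k : Fin M with k.val < n, ℓ k

/-- The set `𝓛_r`, `1 ≤ r ≤ N`: the index vectors `ℓ` with `0 ≤ ℓ_k ≤ L_k - 1` for all `k`, with
`λ_{r-1} = 0` and, if `r ≤ N - 1`, with `λ_r > 0`. -/
def indexSet (L : Fin M → ℕ) (r : ℕ) : Finset (Fin M → ℕ) :=
  {ℓ ∈ Fintype.piFinset fun k => Finset.range (L k) |
    lam ℓ (r - 1) = 0 ∧ (r ≤ M → 0 < lam ℓ r)}

/-- The coefficient `χ_ℓ`. -/
def chi (ρ q θ : Fin (M + 1) → ℝ) (ℓ : Fin M → ℕ) : ℝ :=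
  (2 * q (Fin.last M) / (1 + q (Fin.last M) ^ 2)) ^ (1 + 2 * lam ℓ M) *
    ∏ k : Fin M, θ k.succ ^ lam ℓ (k + 1) / ((ℓ k).factorial : ℝ) *
      (ρ k.castSucc / ρ (Fin.last M)) ^ ℓ k *
      (2 * q k.castSucc / (1 + q k.castSucc ^ 2)) ^ (1 + 2 * lam ℓ k)

/-- The function `η(s)`, for `s` near but different from `1`. -/
def eta (q : Fin (M + 1) → ℝ) (ℓ : Fin M → ℕ) (r : ℕ) (s : ℝ) : ℝ :=
  (s - 1) ^ r * (Real.Gamma (lam ℓ M - s) / Real.Gamma (1 - s)) *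
    ∏ n : Fin (M + 1), Real.Gamma (1 + lam ℓ n - s) *
      ₂F₁ ((1 + lam ℓ n - s) / 2) ((2 + lam ℓ n - s) / 2) (1 : ℝ)
        (((1 - q n ^ 2) / (1 + q n ^ 2)) ^ 2)

/-- The value `η^{(k)}(1)`. The defining formula of `η` is not meaningful at the removable
singularity `s = 1` itself, so this is the limit of `η^{(k)}(s)` as `s → 1`, `s ≠ 1`. -/
def etaDeriv (q : Fin (M + 1) → ℝ) (ℓ : Fin M → ℕ) (r k : ℕ) : ℝ :=
  limUnder (𝓝[≠] (1 : ℝ)) (iteratedDeriv k (eta q ℓ r))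

/-- The constant `ρ_N γth ∏ (1 + q_n ^ 2) ^ 2 / ∏ (4 q_n ^ 2 θ_n)`. -/
def scale (ρ q θ : Fin (M + 1) → ℝ) (γth : ℝ) : ℝ :=
  ρ (Fin.last M) * γth * (∏ n, (1 + q n ^ 2) ^ 2) / ∏ n, 4 * q n ^ 2 * θ n

/-- The high-SNR expansion of the outage probability in the functions `(log γ) ^ p / γ`. -/
def expansion (ρ q θ : Fin (M + 1) → ℝ) (γth : ℝ) (L : Fin M → ℕ) (γ : ℝ) : ℝ :=
  scale ρ q θ γth *
    ∑ r ∈ Finset.Icc 1 (M + 1), ∑ ℓ ∈ indexSet L r,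
      (-1) ^ lam ℓ M * chi ρ q θ ℓ *
        ∑ l ∈ Finset.range r,
          etaDeriv q ℓ r (r - 1 - l) / (((r - 1 - l).factorial : ℝ) * (l.factorial : ℝ)) *
            ∑ p ∈ Finset.range (l + 1),
              (l.choose p : ℝ) * (-1) ^ p * Real.log (scale ρ q θ γth) ^ (l - p) *
                (Real.log γ ^ p / γ)

/-- The leading-order term of the outage probability. -/
def leading (ρ q θ : Fin (M + 1) → ℝ) (γth : ℝ) (γ : ℝ) : ℝ :=
  ρ (Fin.last M) * γth / (M.factorial : ℝ) *
    (∏ n, (1 + q n ^ 2) / (2 * q n * θ n)) * (Real.log γ ^ M / γ)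

end Expansion

end HoytRelay

end

/-! With `Y_n = X_1 ⋯ X_n`, outage at reference signal-to-noise ratio `γ` is the event
`γ / γth < ∑ ρ_n / Y_n`. If positive independent variables have `P(X_n < t) ∼ c_n t` as `t → 0+`,
then `P(Y_n < t) ∼ c_1 ⋯ c_n t (log (1 / t)) ^ (n - 1) / (n - 1)!`: near zero a new factor acts
like `c` times a uniform variable, so that it turns the lower tail `F` of the product into
`c t ∫_t^1 F(y) / y ^ 2 dy`, which after `y = exp (-w)` integrates a power of `w` once more. Hence
the summand `n = N` has one logarithm more than the others and determines the outage probability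
to leading order; for the Hoyt law `c_n` is the value of the density at `0`. In the expansion only
`r = N`, `ℓ = 0`, `l = N - 1` contributes to the order `(log γ) ^ (N - 1) / γ`. It has the same
leading coefficient, so both equivalences hold. -/

namespace HoytRelay

section Hypergeometric

lemma one_le_radius_ordinaryHypergeometricSeries (a b c : ℂ) :
    1 ≤ (ordinaryHypergeometricSeries ℂ a b c).radius := by
  by_cases! habc : ∀ k : ℕ, ↑k ≠ -a ∧ ↑k ≠ -b ∧ ↑k ≠ -c
  · exact (ordinaryHypergeometricSeries_radius_eq_one ℂ a b c habc).ge
  obtain ⟨k, hk⟩ := habc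
  refine le_top.trans_eq (Eq.symm ?_)
  by_cases ha : (k : ℂ) = -a
  · rw [← neg_neg a, ← ha, ordinaryHypergeometric_radius_top_of_neg_nat₁]
  by_cases hb : (k : ℂ) = -b
  · rw [← neg_neg b, ← hb, ordinaryHypergeometric_radius_top_of_neg_nat₂]
  · rw [← neg_neg c, ← hk ha hb, ordinaryHypergeometric_radius_top_of_neg_nat₃]

lemma norm_ascPochhammer_eval_le {a : ℂ} {A : ℝ} (h : ‖a‖ ≤ A) (k : ℕ) :
    ‖(ascPochhammer ℂ k).eval a‖ ≤ ‖(ascPochhammer ℂ k).eval (A : ℂ)‖ := by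
  induction k with
  | zero => simp
  | succ k ih =>
    simp only [ascPochhammer_succ_eval, norm_mul]
    have hA : ‖(A : ℂ) + k‖ = A + k := by
      rw [← Complex.ofReal_natCast, ← Complex.ofReal_add, Complex.norm_real]
      exact Real.norm_of_nonneg (add_nonneg ((norm_nonneg a).trans h) k.cast_nonneg)
    have hstep : ‖a + k‖ ≤ ‖(A : ℂ) + k‖ := by
      rw [hA]
      exact (norm_add_le _ _).trans (by simpa using h)
    gcongr

lemma analyticAt_ordinaryHypergeometric {f g : ℂ → ℂ} {w₀ z : ℂ} (hf : AnalyticAt ℂ f w₀)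
    (hg : AnalyticAt ℂ g w₀) (c : ℂ) (hz : ‖z‖ < 1) :
    AnalyticAt ℂ (fun w => ₂F₁ (f w) (g w) c z) w₀ := by
  have hbound {φ : ℂ → ℂ} (hφ : AnalyticAt ℂ φ w₀) : ∀ᶠ w in 𝓝 w₀, ‖φ w‖ ≤ ‖φ w₀‖ + 1 :=
    hφ.continuousAt.norm.eventually_le_const (lt_add_one _)
  obtain ⟨U, hU, hUopen, hwU⟩ := eventually_nhds_iff.1
    (((hf.eventually_analyticAt.and hg.eventually_analyticAt).and (hbound hf)).and (hbound hg))
  set A := ‖f w₀‖ + 1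
  set B := ‖g w₀‖ + 1
  have hsum : Summable fun k => ‖ordinaryHypergeometricCoefficient (A : ℂ) B c k • z ^ k‖ := by
    simpa only [ordinaryHypergeometricSeries_apply_eq] using
      (ordinaryHypergeometricSeries ℂ (A : ℂ) B c).summable_norm_apply (x := z) (by
        have : ‖z‖ₑ < 1 := by simpa [enorm_eq_nnnorm, ← NNReal.coe_lt_coe] using hz
        simpa using this.trans_le (one_le_radius_ordinaryHypergeometricSeries A B c))
  have hdiff (k : ℕ) : DifferentiableOn ℂ
      (fun w => ordinaryHypergeometricCoefficient (f w) (g w) c k • z ^ k) U := by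
    intro w hw
    have hpoch {φ : ℂ → ℂ} (hφ : AnalyticAt ℂ φ w) :
        DifferentiableAt ℂ (fun w => (ascPochhammer ℂ k).eval (φ w)) w :=
      (ascPochhammer ℂ k).differentiable.differentiableAt.comp w hφ.differentiableAt
    exact ((((hpoch (hU w hw).1.1.1).const_mul _).mul (hpoch (hU w hw).1.1.2)).mul_const
      _).smul_const _ |>.differentiableWithinAt
  have hle (k : ℕ) (w : ℂ) (hw : w ∈ U) :
      ‖ordinaryHypergeometricCoefficient (f w) (g w) c k • z ^ k‖ ≤
        ‖ordinaryHypergeometricCoefficient (A : ℂ) B c k • z ^ k‖ := by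
    simp only [norm_smul, norm_mul]
    gcongr
    · exact norm_ascPochhammer_eval_le (hU w hw).1.2 k
    · exact norm_ascPochhammer_eval_le (hU w hw).2 k
  simpa only [ordinaryHypergeometric_eq_tsum] using
    (Complex.differentiableOn_tsum_of_summable_norm hsum hdiff hUopen hle).analyticAt
      (hUopen.mem_nhds hwU)

lemma ofReal_ordinaryHypergeometric (a b c z : ℝ) :
    ((₂F₁ a b c z : ℝ) : ℂ) = ₂F₁ (a : ℂ) (b : ℂ) (c : ℂ) (z : ℂ) := by
  have hpoch (x : ℝ) (k : ℕ) :
      (ascPochhammer ℂ k).eval (x : ℂ) = ((ascPochhammer ℝ k).eval x : ℝ) := by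
    rw [← ascPochhammer_map Complex.ofRealHom, ← Complex.ofRealHom_eq_coe,
      Polynomial.eval_map_apply]
    rfl
  simp only [ordinaryHypergeometric_eq_tsum, hpoch, smul_eq_mul]
  push_cast
  rfl

lemma analyticAt_ordinaryHypergeometric_sub_div_two (a b c s : ℝ) {z : ℝ} (hz : |z| < 1) :
    AnalyticAt ℝ (fun s : ℝ => ₂F₁ ((a - s) / 2) ((b - s) / 2) c z) s := by
  have h (a : ℝ) : AnalyticAt ℂ (fun w : ℂ => ((a : ℂ) - w) / 2) (s : ℂ) := by
    fun_prop (disch := norm_num)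
  have hF := (analyticAt_ordinaryHypergeometric (h a) (h b) (c : ℂ) (z := (z : ℂ))
    (by rwa [Complex.norm_real])).re_ofReal
  refine hF.congr (.of_forall fun s => ?_)
  beta_reduce
  rw [← Complex.ofReal_re (₂F₁ _ _ _ _), ofReal_ordinaryHypergeometric]
  push_cast
  rfl

lemma ordinaryHypergeometric_zero_left {𝕂 : Type*} [Field 𝕂] [TopologicalSpace 𝕂]
    [IsTopologicalRing 𝕂] (b c z : 𝕂) : ₂F₁ (0 : 𝕂) b c z = 1 := by
  rw [ordinaryHypergeometric_eq_tsum]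
  refine (tsum_eq_single 0 fun k hk => ?_).trans (by simp)
  simp [hk]

end Hypergeometric

section Gamma

lemma exists_tendsto_iteratedDeriv {f : ℝ → ℝ} {x c : ℝ} (hf : MeromorphicAt f x)
    (hc : Tendsto f (𝓝[≠] x) (𝓝 c)) (k : ℕ) :
    ∃ a, Tendsto (iteratedDeriv k f) (𝓝[≠] x) (𝓝 a) := by
  obtain ⟨g, hg, hfg⟩ := hf.meromorphicOrderAt_nonneg_iff.1
    ((tendsto_nhds_iff_meromorphicOrderAt_nonneg hf).1 ⟨c, hc⟩)
  have hderiv : iteratedDeriv k f =ᶠ[𝓝[≠] x] iteratedDeriv k g := by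
    filter_upwards [eventually_nhdsNE_eventually_nhds_iff.2 hfg] with y hy
    exact EventuallyEq.iteratedDeriv_eq k hy
  have hcont : ContinuousAt (iteratedDeriv k g) x := by
    rw [iteratedDeriv_eq_iterate]
    exact (hg.iterated_deriv k).continuousAt
  exact ⟨_, hcont.continuousWithinAt.tendsto.congr' hderiv.symm⟩

lemma analyticAt_Gamma_inv (x : ℝ) : AnalyticAt ℝ (fun s => (Real.Gamma s)⁻¹) x := by
  have h := (Complex.differentiable_one_div_Gamma.analyticAt (x : ℂ)).re_ofReal
  simpa only [Complex.Gamma_ofReal, ← Complex.ofReal_inv, Complex.ofReal_re] using h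

lemma meromorphicAt_Gamma (x : ℝ) : MeromorphicAt Real.Gamma x := by
  simpa only [Pi.inv_def, inv_inv] using (analyticAt_Gamma_inv x).meromorphicAt.inv

lemma meromorphicAt_Gamma_sub (a s : ℝ) : MeromorphicAt (fun s => Real.Gamma (a - s)) s :=
  (meromorphicAt_Gamma (a - s)).comp_analyticAt (by fun_prop)

lemma tendsto_Gamma_sub {a s₀ : ℝ} (h : s₀ < a) :
    Tendsto (fun s => Real.Gamma (a - s)) (𝓝 s₀) (𝓝 (Real.Gamma (a - s₀))) :=
  (Real.differentiableOn_Gamma_Ioi.differentiableAt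
    (Ioi_mem_nhds (sub_pos.2 h))).continuousAt.tendsto.comp
      (by fun_prop : ContinuousAt (a - ·) s₀)

lemma tendsto_sub_one_mul_Gamma :
    Tendsto (fun s => (s - 1) * Real.Gamma (1 - s)) (𝓝[≠] 1) (𝓝 (-1)) := by
  have h : Tendsto (fun s => -Real.Gamma (2 - s)) (𝓝[≠] 1) (𝓝 (-1)) := by
    have := (tendsto_Gamma_sub (one_lt_two (α := ℝ))).neg
    rw [show (2 : ℝ) - 1 = 1 by norm_num, Real.Gamma_one] at this
    exact this.mono_left nhdsWithin_le_nhds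
  refine h.congr' ?_
  filter_upwards [self_mem_nhdsWithin] with s hs
  rw [show 2 - s = 1 - s + 1 by ring, Real.Gamma_add_one (sub_ne_zero.2 (Ne.symm hs))]
  ring

lemma eventually_Gamma_one_sub_ne_zero : ∀ᶠ s in 𝓝[≠] (1 : ℝ), Real.Gamma (1 - s) ≠ 0 := by
  filter_upwards [tendsto_sub_one_mul_Gamma.eventually_ne (neg_ne_zero.2 one_ne_zero)] with s hs
  exact right_ne_zero_of_mul hs

lemma tendsto_Gamma_neg_div :
    Tendsto (fun s => Real.Gamma (-s) / Real.Gamma (1 - s)) (𝓝[≠] 1) (𝓝 (-1)) := by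
  have h : Tendsto (fun s : ℝ => (-s)⁻¹) (𝓝[≠] 1) (𝓝 (-1)) := by
    have : ContinuousAt (fun s : ℝ => (-s)⁻¹) 1 := by fun_prop (disch := norm_num)
    simpa [inv_neg] using this.tendsto.mono_left nhdsWithin_le_nhds
  refine h.congr' ?_
  filter_upwards [eventually_Gamma_one_sub_ne_zero,
    eventually_ne_nhdsWithin (one_ne_zero (α := ℝ))] with s hΓ hs
  have hrec : Real.Gamma (1 - s) = -s * Real.Gamma (-s) := by
    rw [← Real.Gamma_add_one (neg_ne_zero.2 hs), neg_add_eq_sub]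
  rw [hrec, div_mul_cancel_right₀ (right_ne_zero_of_mul (hrec ▸ hΓ))]

lemma exists_tendsto_Gamma_div (m : ℕ) :
    ∃ c, Tendsto (fun s => Real.Gamma (m - s) / Real.Gamma (1 - s)) (𝓝[≠] 1) (𝓝 c) := by
  obtain rfl | rfl | hm : m = 0 ∨ m = 1 ∨ 1 < m := by omega
  · exact ⟨-1, by simpa using tendsto_Gamma_neg_div⟩
  · refine ⟨1, tendsto_const_nhds.congr' ?_⟩
    filter_upwards [eventually_Gamma_one_sub_ne_zero] with s hs
    rw [Nat.cast_one, div_self hs]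
  · have hnum := tendsto_Gamma_sub (Nat.one_lt_cast (α := ℝ).2 hm)
    have hden := (analyticAt_Gamma_inv (1 - 1)).continuousAt.tendsto.comp
      (by fun_prop : ContinuousAt (fun s : ℝ => 1 - s) 1)
    exact ⟨_, (hnum.mul hden).mono_left nhdsWithin_le_nhds⟩

end Gamma

section Eta

variable {M : ℕ}

lemma lam_mono (ℓ : Fin M → ℕ) : Monotone (lam ℓ) := fun _ _ hab =>
  Finset.sum_le_sum_of_subset (Finset.monotone_filter_right _ fun _ _ hk => hk.trans_le hab)

lemma lam_zero (n : ℕ) : lam (0 : Fin M → ℕ) n = 0 := by simp [lam]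

lemma abs_hoyt_argument_lt_one {x : ℝ} (hx : 0 < x) : |((1 - x ^ 2) / (1 + x ^ 2)) ^ 2| < 1 := by
  have hx2 : 0 < x ^ 2 := by positivity
  rw [abs_of_nonneg (sq_nonneg _), sq_lt_one_iff_abs_lt_one, abs_div,
    abs_of_pos (add_pos one_pos hx2), div_lt_one (by positivity), abs_lt]
  constructor <;> linarith

/-- The factor `(s - 1) ^ r` cancels exactly the poles of `Γ(1 + λ_{n-1} - s)`, `n ≤ r`. -/
lemma eta_eq {r : ℕ} (hr : r ≤ M + 1) (q : Fin (M + 1) → ℝ) (ℓ : Fin M → ℕ) (s : ℝ) :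
    eta q ℓ r s = Real.Gamma (lam ℓ M - s) / Real.Gamma (1 - s) *
      ∏ n : Fin (M + 1), (if n.val < r then s - 1 else 1) * Real.Gamma (1 + lam ℓ n - s) *
        ₂F₁ ((1 + lam ℓ n - s) / 2) ((2 + lam ℓ n - s) / 2) (1 : ℝ)
          (((1 - q n ^ 2) / (1 + q n ^ 2)) ^ 2) := by
  have h : ∏ n : Fin (M + 1), (if n.val < r then s - 1 else 1) = (s - 1) ^ r := by
    rw [Finset.prod_ite, Finset.prod_const, Finset.prod_const_one, mul_one,
      Fin.card_filter_val_lt, min_eq_right hr]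
  simp only [mul_assoc, Finset.prod_mul_distrib, h, eta]
  ring

lemma meromorphicAt_eta {q : Fin (M + 1) → ℝ} (hq : ∀ n, 0 < q n) (ℓ : Fin M → ℕ) (r : ℕ)
    (s : ℝ) : MeromorphicAt (eta q ℓ r) s := by
  have hpow : MeromorphicAt (fun s : ℝ => (s - 1) ^ r) s :=
    AnalyticAt.meromorphicAt (by fun_prop)
  refine (hpow.mul ((meromorphicAt_Gamma_sub _ s).div (meromorphicAt_Gamma_sub 1 s))).mul ?_
  refine MeromorphicAt.fun_prod fun n _ => (meromorphicAt_Gamma_sub _ s).mul ?_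
  exact (analyticAt_ordinaryHypergeometric_sub_div_two _ _ 1 s
    (abs_hoyt_argument_lt_one (hq n))).meromorphicAt

lemma tendsto_sub_one_mul_Gamma_factor {m r n : ℕ} (h0 : n < r → m = 0) (h1 : r ≤ n → 0 < m) :
    Tendsto (fun s => (if n < r then s - 1 else 1) * Real.Gamma (1 + m - s)) (𝓝[≠] 1)
      (𝓝 (if n < r then -1 else Real.Gamma m)) := by
  by_cases hn : n < r
  · simpa only [hn, if_true, h0 hn, Nat.cast_zero, add_zero] using tendsto_sub_one_mul_Gamma
  · have hm : (1 : ℝ) < 1 + m := by simpa using h1 (not_lt.1 hn)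
    simpa only [hn, if_false, one_mul, add_sub_cancel_left] using
      (tendsto_Gamma_sub hm).mono_left nhdsWithin_le_nhds

lemma tendsto_eta {q : Fin (M + 1) → ℝ} (hq : ∀ n, 0 < q n) {ℓ : Fin M → ℕ} {r : ℕ}
    (hr : r ≤ M + 1) (h0 : ∀ n < r, lam ℓ n = 0) (h1 : ∀ n ≤ M, r ≤ n → 0 < lam ℓ n) {c : ℝ}
    (hc : Tendsto (fun s => Real.Gamma (lam ℓ M - s) / Real.Gamma (1 - s)) (𝓝[≠] 1) (𝓝 c)) :
    Tendsto (eta q ℓ r) (𝓝[≠] 1) (𝓝 (c * ∏ n : Fin (M + 1),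
      (if n.val < r then -1 else Real.Gamma (lam ℓ n)) *
        ₂F₁ ((1 + lam ℓ n - 1 : ℝ) / 2) ((2 + lam ℓ n - 1) / 2) (1 : ℝ)
          (((1 - q n ^ 2) / (1 + q n ^ 2)) ^ 2))) := by
  have hF (n : Fin (M + 1)) := (analyticAt_ordinaryHypergeometric_sub_div_two (1 + lam ℓ n)
    (2 + lam ℓ n) 1 1 (abs_hoyt_argument_lt_one (hq n))).continuousAt.continuousWithinAt.tendsto
      (s := {1}ᶜ)
  have hΓ (n : Fin (M + 1)) :=
    tendsto_sub_one_mul_Gamma_factor (h0 n) (h1 n (Nat.lt_succ_iff.1 n.2))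
  simp only [funext (eta_eq hr q ℓ)]
  exact hc.mul (tendsto_finsetProd _ fun n _ => (hΓ n).mul (hF n))

lemma tendsto_iteratedDeriv_eta {q : Fin (M + 1) → ℝ} (hq : ∀ n, 0 < q n) {L ℓ : Fin M → ℕ}
    {r : ℕ} (hr : r ∈ Finset.Icc 1 (M + 1)) (hℓ : ℓ ∈ indexSet L r) (k : ℕ) :
    Tendsto (iteratedDeriv k (eta q ℓ r)) (𝓝[≠] (1 : ℝ)) (𝓝 (etaDeriv q ℓ r k)) := by
  rw [Finset.mem_Icc] at hr
  obtain ⟨-, hprev, hnext⟩ := Finset.mem_filter.1 hℓ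
  have h0 (n : ℕ) (hn : n < r) : lam ℓ n = 0 :=
    Nat.eq_zero_of_le_zero (hprev ▸ lam_mono ℓ (Nat.le_sub_one_of_lt hn))
  have h1 (n : ℕ) (hn : n ≤ M) (hrn : r ≤ n) : 0 < lam ℓ n :=
    (hnext (hrn.trans hn)).trans_le (lam_mono ℓ hrn)
  obtain ⟨c, hc⟩ := exists_tendsto_Gamma_div (lam ℓ M)
  exact tendsto_nhds_limUnder <|
    exists_tendsto_iteratedDeriv (meromorphicAt_eta hq ℓ r 1) (tendsto_eta hq hr.2 h0 h1 hc) k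

lemma etaDeriv_zero {q : Fin (M + 1) → ℝ} (hq : ∀ n, 0 < q n) :
    etaDeriv q 0 (M + 1) 0 = (-1) ^ M := by
  have hratio : Tendsto (fun s => Real.Gamma (lam (0 : Fin M → ℕ) M - s) / Real.Gamma (1 - s))
      (𝓝[≠] 1) (𝓝 (-1)) := by
    simpa only [lam_zero, Nat.cast_zero, zero_sub] using tendsto_Gamma_neg_div
  have h := tendsto_eta hq le_rfl (fun n _ => lam_zero n)
    (fun n hn hn' => absurd hn' (by omega)) hratio
  simp only [lam_zero, Nat.cast_zero, add_zero, sub_self, zero_div,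
    ordinaryHypergeometric_zero_left, Fin.is_lt, if_true, mul_one, Finset.prod_const,
    Finset.card_univ, Fintype.card_fin] at h
  rw [etaDeriv, iteratedDeriv_zero, h.limUnder_eq, pow_succ]
  ring

end Eta

section LogTail

/-- `HasLogTail F m C` means `F t ∼ C t (log (1 / t)) ^ m` as `t → 0+` (and
`F t = o (t (log (1 / t)) ^ m)` if `C = 0`). It is used for the lower tail `F t = P(X < t)` of a
random variable. -/
def HasLogTail (F : ℝ → ℝ) (m : ℕ) (C : ℝ) : Prop :=
  Tendsto (fun t => F t / (t * (-Real.log t) ^ m)) (𝓝[>] 0) (𝓝 C)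

lemma tendsto_neg_log_nhdsGT_zero : Tendsto (fun t => -Real.log t) (𝓝[>] 0) atTop :=
  tendsto_neg_atBot_atTop.comp Real.tendsto_log_nhdsGT_zero

lemma eventually_neg_log_pos : ∀ᶠ t in 𝓝[>] (0 : ℝ), 0 < -Real.log t :=
  tendsto_neg_log_nhdsGT_zero.eventually_gt_atTop 0

lemma tendsto_neg_log_const_mul_div {a : ℝ} (ha : 0 < a) :
    Tendsto (fun t => -Real.log (a * t) / -Real.log t) (𝓝[>] 0) (𝓝 1) := by
  have h : Tendsto (fun t => -Real.log a / -Real.log t + 1) (𝓝[>] 0) (𝓝 (0 + 1)) :=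
    (tendsto_neg_log_nhdsGT_zero.const_div_atTop _).add_const 1
  rw [zero_add] at h
  refine h.congr' ?_
  filter_upwards [self_mem_nhdsWithin, eventually_neg_log_pos] with t ht hl
  rw [Real.log_mul ha.ne' (ne_of_gt ht), neg_add, add_div, div_self hl.ne']

namespace HasLogTail

variable {F G : ℝ → ℝ} {m k : ℕ} {C D : ℝ}

lemma congr (hF : HasLogTail F m C) (h : ∀ᶠ t in 𝓝[>] 0, F t = G t) : HasLogTail G m C :=
  Tendsto.congr' (h.mono fun t ht => by rw [ht]) hF

lemma add (hF : HasLogTail F m C) (hG : HasLogTail G m D) :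
    HasLogTail (fun t => F t + G t) m (C + D) := by
  simpa only [HasLogTail, add_div] using Tendsto.add hF hG

lemma const_mul (hF : HasLogTail F m C) (a : ℝ) : HasLogTail (fun t => a * F t) m (a * C) := by
  simpa only [HasLogTail, mul_div_assoc] using Tendsto.const_mul a hF

protected lemma self : HasLogTail (fun t => t) 0 1 := by
  refine Tendsto.congr' ?_ tendsto_const_nhds
  filter_upwards [self_mem_nhdsWithin] with t (ht : 0 < t)
  rw [pow_zero, mul_one, div_self ht.ne']

lemma comp_const_mul (hF : HasLogTail F m C) {a : ℝ} (ha : 0 < a) :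
    HasLogTail (fun t => F (a * t)) m (a * C) := by
  have hmaps : Tendsto (fun t : ℝ => a * t) (𝓝[>] 0) (𝓝[>] 0) := by
    refine tendsto_nhdsWithin_iff.2 ⟨?_, ?_⟩
    · simpa using ((by fun_prop : Continuous fun t => a * t).tendsto 0).mono_left
        nhdsWithin_le_nhds
    · filter_upwards [self_mem_nhdsWithin] with t ht using mul_pos ha ht
  have h := ((Tendsto.comp hF hmaps).mul ((tendsto_neg_log_const_mul_div ha).pow m)).const_mul a
  rw [one_pow, mul_one] at h
  refine Tendsto.congr' ?_ h
  filter_upwards [self_mem_nhdsWithin, eventually_neg_log_pos,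
    hmaps.eventually eventually_neg_log_pos] with t (ht : 0 < t) _ hl'
  rw [Function.comp_apply, div_pow]
  field_simp

lemma lower_order (hF : HasLogTail F m C) (hmk : m < k) : HasLogTail F k 0 := by
  obtain ⟨j, rfl⟩ := Nat.exists_eq_add_of_lt hmk
  have h := Tendsto.mul hF
    ((tendsto_inv_atTop_zero.comp tendsto_neg_log_nhdsGT_zero).pow (j + 1))
  rw [zero_pow (Nat.succ_ne_zero j), mul_zero] at h
  refine Tendsto.congr (fun t => ?_) h
  rw [Function.comp_apply, inv_pow, ← div_eq_mul_inv, div_div, mul_assoc, ← pow_add, ← add_assoc]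

lemma of_forall_squeeze {a b : ℝ → ℝ} (ha : Tendsto a (𝓝[>] 0) (𝓝 C))
    (hb : Tendsto b (𝓝[>] 0) (𝓝 C))
    (h : ∀ᶠ ε in 𝓝[>] (0 : ℝ), ∃ U V : ℝ → ℝ, HasLogTail U m (a ε) ∧ HasLogTail V m (b ε) ∧
      ∀ᶠ t in 𝓝[>] 0, U t ≤ F t ∧ F t ≤ V t) : HasLogTail F m C := by
  have hpos : ∀ᶠ t in 𝓝[>] (0 : ℝ), 0 < t * (-Real.log t) ^ m := by
    filter_upwards [self_mem_nhdsWithin, eventually_neg_log_pos] with t ht hl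
      using mul_pos ht (pow_pos hl m)
  refine tendsto_order.2 ⟨fun x hx => ?_, fun x hx => ?_⟩
  · obtain ⟨ε, hε, U, V, hU, -, hF⟩ := ((ha.eventually_const_lt hx).and h).exists
    filter_upwards [hF, hpos, Tendsto.eventually_const_lt hε hU] with t hFt ht hUt
    exact hUt.trans_le (div_le_div_of_nonneg_right hFt.1 ht.le)
  · obtain ⟨ε, hε, U, V, -, hV, hF⟩ := ((hb.eventually_lt_const hx).and h).exists
    filter_upwards [hF, hpos, Tendsto.eventually_lt_const hε hV] with t hFt ht hVt
    exact (div_le_div_of_nonneg_right hFt.2 ht.le).trans_lt hVt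

lemma tendsto_zero (hF : HasLogTail F m C) : Tendsto F (𝓝[>] 0) (𝓝 0) := by
  have hlog : Tendsto (fun t => t * (-Real.log t) ^ m) (𝓝[>] 0) (𝓝 0) := by
    refine ((Real.tendsto_pow_mul_exp_neg_atTop_nhds_zero m).comp
      tendsto_neg_log_nhdsGT_zero).congr' ?_
    filter_upwards [self_mem_nhdsWithin] with t ht
    rw [Function.comp_apply, neg_neg, Real.exp_log ht, mul_comm]
  have h := Tendsto.mul hF hlog
  rw [mul_zero] at h
  refine h.congr' ?_
  filter_upwards [self_mem_nhdsWithin, eventually_neg_log_pos] with t (ht : 0 < t) hl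
  exact div_mul_cancel₀ _ (mul_pos ht (pow_pos hl m)).ne'

lemma tendsto_atTop (hF : HasLogTail F m C) :
    Tendsto (fun γ => F γ⁻¹ / (Real.log γ ^ m / γ)) atTop (𝓝 C) := by
  refine (Tendsto.comp hF tendsto_inv_atTop_nhdsGT_zero).congr fun γ => ?_
  rw [Function.comp_apply, Real.log_inv, neg_neg, mul_comm, ← div_eq_mul_inv]

end HasLogTail

end LogTail

section LowerTail

lemma isLittleO_intervalIntegral {E : Type*} [NormedAddCommGroup E] [NormedSpace ℝ E]
    {f : ℝ → E} {g : ℝ → ℝ} {a : ℝ} (hf : ∀ b, IntervalIntegrable f volume a b)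
    (hg : ∀ b, IntervalIntegrable g volume a b) (hg0 : ∀ᶠ x in atTop, 0 ≤ g x)
    (hgtop : Tendsto (fun b => ∫ x in a..b, g x) atTop atTop) (hfg : f =o[atTop] g) :
    (fun b => ∫ x in a..b, f x) =o[atTop] fun b => ∫ x in a..b, g x := by
  refine isLittleO_iff.2 fun ε hε => ?_
  obtain ⟨c, hc⟩ := eventually_atTop.1 ((hfg.def (half_pos hε)).and hg0)
  have hconst := hgtop.eventually_ge_atTop
    (2 / ε * (‖∫ x in a..c, f x‖ - ε / 2 * ∫ x in a..c, g x))
  filter_upwards [eventually_ge_atTop c, hconst, hgtop.eventually_ge_atTop 0] with b hcb hb hb0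
  have hfc : IntervalIntegrable f volume c b := (hf c).symm.trans (hf b)
  have hgc : IntervalIntegrable g volume c b := (hg c).symm.trans (hg b)
  have htail : ‖∫ x in c..b, f x‖ ≤ ε / 2 * ∫ x in c..b, g x := by
    rw [← intervalIntegral.integral_const_mul]
    refine intervalIntegral.norm_integral_le_of_norm_le hcb (Eventually.of_forall fun x hx => ?_)
      (hgc.const_mul _)
    obtain ⟨hle, hx0⟩ := hc x hx.1.le
    rwa [Real.norm_of_nonneg hx0] at hle
  rw [Real.norm_of_nonneg hb0, ← intervalIntegral.integral_add_adjacent_intervals (hf c) hfc]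
  have hsplit := intervalIntegral.integral_add_adjacent_intervals (hg c) hgc
  rw [div_mul_eq_mul_div, div_le_iff₀ hε] at hb
  refine (norm_add_le _ _).trans ?_
  rw [← hsplit] at hb ⊢
  linarith

lemma tendsto_intervalIntegral_div_pow_succ {f : ℝ → ℝ} {m : ℕ} {C : ℝ}
    (hf : ∀ b, IntervalIntegrable f volume 0 b)
    (hlim : Tendsto (fun x => f x / x ^ m) atTop (𝓝 C)) :
    Tendsto (fun b => (∫ x in (0 : ℝ)..b, f x) / b ^ (m + 1)) atTop (𝓝 (C / (m + 1))) := by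
  have hm : (m + 1 : ℝ) ≠ 0 := by positivity
  have hpow (b : ℝ) : ∫ x in (0 : ℝ)..b, x ^ m = b ^ (m + 1) / (m + 1) := by simp
  have hdiff : (fun x => f x - C * x ^ m) =o[atTop] fun x => x ^ m := by
    refine (isLittleO_iff_tendsto' ?_).2 ?_
    · filter_upwards [eventually_gt_atTop 0] with x hx h using absurd h (pow_pos hx m).ne'
    · have h := hlim.sub_const C
      rw [sub_self] at h
      refine h.congr' ?_
      filter_upwards [eventually_gt_atTop 0] with x hx
      rw [sub_div, mul_div_cancel_right₀ _ (pow_pos hx m).ne']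
  have hint (b : ℝ) : IntervalIntegrable (fun x => C * x ^ m) volume 0 b :=
    (by fun_prop : Continuous fun x => C * x ^ m).intervalIntegrable _ _
  have hlittle := isLittleO_intervalIntegral (fun b => (hf b).sub (hint b))
    (fun b => (continuous_pow m).intervalIntegrable 0 b)
    ((eventually_ge_atTop 0).mono fun x hx => pow_nonneg hx m)
    (by simpa only [hpow] using
      (tendsto_pow_atTop m.succ_ne_zero).atTop_div_const (by positivity)) hdiff
  have h := (hlittle.tendsto_div_nhds_zero.div_const (m + 1)).add_const (C / (m + 1))
  rw [zero_div, zero_add] at h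
  refine h.congr' ?_
  filter_upwards [eventually_gt_atTop 0] with b hb
  have hb' := (pow_pos hb (m + 1)).ne'
  rw [intervalIntegral.integral_sub (hf b) (hint b), intervalIntegral.integral_const_mul, hpow]
  field_simp
  ring

/-- For `U` uniform on `(0, 1)` and `y > 0`, the probability of `U * y < t` is `min 1 (t / y)`. The
lower cutoff at `t` changes this only for `1 < y`. -/
noncomputable def truncatedRatio (t y : ℝ) : ℝ :=
  max t (min 1 (t / y))

lemma truncatedRatio_eq_mul_exp {t y : ℝ} (ht : 0 < t) (hy : 0 < y) :
    truncatedRatio t y = t * Real.exp (max 0 (min (-Real.log y) (-Real.log t))) := by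
  rw [Real.exp_monotone.map_max, Real.exp_monotone.map_min, Real.exp_zero, Real.exp_neg,
    Real.exp_neg, Real.exp_log hy, Real.exp_log ht, mul_max_of_nonneg _ _ ht.le,
    mul_min_of_nonneg _ _ ht.le, mul_inv_cancel₀ ht.ne', mul_one, min_comm, truncatedRatio,
    div_eq_mul_inv]

lemma truncatedRatio_mem_Icc {t : ℝ} (ht : 0 < t) (ht1 : t ≤ 1) (y : ℝ) :
    truncatedRatio t y ∈ Set.Icc 0 1 :=
  ⟨ht.le.trans (le_max_left _ _), max_le ht1 (min_le_left _ _)⟩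

/-- The linear approximation of `H` is not available for `δ ≤ t / y`, but then `y < (2 / δ) * t`,
an event of lower order than the integral of `truncatedRatio t`. -/
lemma truncatedRatio_sandwich {H : ℝ → ℝ} {c ε δ t y : ℝ} (hH : ∀ s, H s ∈ Set.Icc 0 1)
    (hc : 0 ≤ c) (hε : 0 ≤ ε) (hδ : 0 < δ) (hδ1 : δ ≤ 1)
    (hlin : ∀ s ∈ Set.Ioo 0 δ, |H s / s - c| ≤ ε) (ht : 0 < t) (ht1 : t ≤ 1) (hy : 0 < y) :
    (c - ε) * truncatedRatio t y - c * t -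
        c * (Set.Iio (2 / δ * t)).indicator 1 y ≤ H (t / y) ∧
      H (t / y) ≤ (c + ε) * truncatedRatio t y + (Set.Iio (2 / δ * t)).indicator 1 y := by
  have hs : 0 < t / y := div_pos ht hy
  obtain ⟨hg0, hg1⟩ := truncatedRatio_mem_Icc ht ht1 y
  have hind : (0 : ℝ) ≤ (Set.Iio (2 / δ * t)).indicator 1 y :=
    Set.indicator_nonneg (fun _ _ => zero_le_one) y
  obtain hsδ | hsδ := lt_or_ge (t / y) δ
  · have habs := abs_le.1 (hlin _ ⟨hs, hsδ⟩)
    have hlow : (c - ε) * (t / y) ≤ H (t / y) := by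
      rw [← le_div_iff₀ hs]
      linarith [habs.1]
    have hup : H (t / y) ≤ (c + ε) * (t / y) := by
      rw [← div_le_iff₀ hs]
      linarith [habs.2]
    have hmin : truncatedRatio t y = max t (t / y) := by
      rw [truncatedRatio, min_eq_right (hsδ.le.trans hδ1)]
    have hle : t / y ≤ truncatedRatio t y := hmin ▸ le_max_right _ _
    have hge : truncatedRatio t y ≤ t / y + t := by
      rw [hmin]
      exact max_le (by linarith) (by linarith)
    have := mul_le_mul_of_nonneg_left hge hc
    have := mul_le_mul_of_nonneg_left hle hε
    have := mul_le_mul_of_nonneg_left hle hc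
    have := mul_nonneg hc hind
    constructor <;> linarith
  · have hmem : y ∈ Set.Iio (2 / δ * t) := by
      rw [le_div_iff₀ hy] at hsδ
      rw [Set.mem_Iio, div_mul_eq_mul_div, lt_div_iff₀ hδ]
      linarith
    rw [Set.indicator_of_mem hmem, Pi.one_apply]
    have := mul_le_mul_of_nonneg_left hg1 hc
    have := mul_nonneg hc ht.le
    have := mul_nonneg hc hg0
    have := mul_nonneg hε hg0
    constructor <;> linarith [(hH (t / y)).1, (hH (t / y)).2]

variable {Ω : Type*} [MeasurableSpace Ω] {P : Measure Ω}

lemma integral_indicator_Iio {Y : Ω → ℝ} (hY : AEMeasurable Y P) (a : ℝ) :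
    ∫ ω, (Set.Iio a).indicator (1 : ℝ → ℝ) (Y ω) ∂P = P.real {ω | Y ω < a} := by
  rw [← integral_map hY (measurable_one.indicator measurableSet_Iio).aestronglyMeasurable,
    integral_indicator_one measurableSet_Iio,
    map_measureReal_apply_of_aemeasurable hY measurableSet_Iio]
  rfl

section IsFiniteMeasure

variable [IsFiniteMeasure P]

lemma monotone_measureReal_lt (Y : Ω → ℝ) : Monotone fun t => P.real {ω | Y ω < t} :=
  fun _ _ htu => measureReal_mono fun _ hω => lt_of_lt_of_le hω htu

lemma integrable_indicator_Iio {Y : Ω → ℝ} (hY : AEMeasurable Y P) (a : ℝ) :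
    Integrable (fun ω => (Set.Iio a).indicator (1 : ℝ → ℝ) (Y ω)) P :=
  Integrable.of_mem_Icc 0 1 ((measurable_one.indicator measurableSet_Iio).comp_aemeasurable hY)
    (Eventually.of_forall fun _ => ⟨Set.indicator_nonneg (fun _ _ => zero_le_one) _,
      Set.indicator_le_self' (fun _ _ => zero_le_one) _⟩)

lemma ae_pos_of_hasLogTail {Y : Ω → ℝ} {m : ℕ} {C : ℝ}
    (hY : HasLogTail (fun t => P.real {ω | Y ω < t}) m C) : ∀ᵐ ω ∂P, 0 < Y ω := by
  have hzero : P.real {ω | Y ω ≤ 0} = 0 := by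
    refine le_antisymm (ge_of_tendsto hY.tendsto_zero ?_) measureReal_nonneg
    filter_upwards [self_mem_nhdsWithin] with t (ht : 0 < t)
    exact measureReal_mono fun ω hω => lt_of_le_of_lt hω ht
  rw [ae_iff]
  simpa only [not_lt] using (measureReal_eq_zero_iff).1 hzero

lemma HasLogTail.measureReal_lt_add {W V : Ω → ℝ} {m : ℕ} {C : ℝ} (hV0 : ∀ᵐ ω ∂P, 0 ≤ V ω)
    (hW : HasLogTail (fun t => P.real {ω | t⁻¹ < W ω}) m C)
    (hV : HasLogTail (fun t => P.real {ω | t⁻¹ < V ω}) m 0) :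
    HasLogTail (fun t => P.real {ω | t⁻¹ < W ω + V ω}) m C := by
  have hlim : Tendsto (fun ε : ℝ => (1 - ε)⁻¹ * C + ε⁻¹ * 0) (𝓝[>] 0) (𝓝 C) := by
    have h : ContinuousAt (fun ε : ℝ => (1 - ε)⁻¹ * C + 0) 0 := by fun_prop (disch := simp)
    simpa [ContinuousAt] using h.tendsto.mono_left nhdsWithin_le_nhds
  refine .of_forall_squeeze tendsto_const_nhds hlim ?_
  filter_upwards [Ioo_mem_nhdsGT zero_lt_one] with ε ⟨hε, hε1⟩
  have hε1' : 0 < (1 - ε)⁻¹ := inv_pos.2 (sub_pos.2 hε1)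
  refine ⟨_, _, hW, (hW.comp_const_mul hε1').add (hV.comp_const_mul (inv_pos.2 hε)),
    Eventually.of_forall fun t => ⟨?_, ?_⟩⟩
  · refine ENNReal.toReal_mono (measure_ne_top _ _) (measure_mono_ae ?_)
    filter_upwards [hV0] with ω hω hωt
    exact lt_add_of_lt_of_nonneg hωt hω
  · refine (measureReal_mono fun ω hω => ?_).trans (measureReal_union_le _ _)
    by_contra hnot
    simp only [Set.mem_union, Set.mem_ofPred, mul_inv, inv_inv, not_or, not_lt] at hnot
    rw [Set.mem_ofPred] at hω
    linarith [hnot.1, hnot.2]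

lemma hasLogTail_measureReal_lt_sum {ι : Type*} {V : ι → Ω → ℝ} {m : ℕ} (s : Finset ι)
    (hV0 : ∀ i, ∀ᵐ ω ∂P, 0 ≤ V i ω)
    (hV : ∀ i, HasLogTail (fun t => P.real {ω | t⁻¹ < V i ω}) m 0) :
    HasLogTail (fun t => P.real {ω | t⁻¹ < ∑ i ∈ s, V i ω}) m 0 := by
  classical
  induction s using Finset.induction_on with
  | empty =>
    refine Tendsto.congr' ?_ tendsto_const_nhds
    filter_upwards [self_mem_nhdsWithin] with t (ht : 0 < t)
    simp [ht.not_gt]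
  | insert i s hi ih =>
    simpa only [Finset.sum_insert hi, add_comm] using ih.measureReal_lt_add (hV0 i) (hV i)

lemma integral_exp_max_zero_min {Z : Ω → ℝ} (hZ : AEMeasurable Z P) {b : ℝ} (hb : 0 ≤ b) :
    ∫ ω, Real.exp (max 0 (min (Z ω) b)) ∂P =
      P.real Set.univ + ∫ w in (0 : ℝ)..b, P.real {ω | w < Z ω} * Real.exp w := by
  have hZb : AEMeasurable (fun ω => max 0 (min (Z ω) b)) P :=
    aemeasurable_const.max (hZ.min aemeasurable_const)
  have hlayer := lintegral_comp_eq_lintegral_meas_lt_mul P (f := fun ω => max 0 (min (Z ω) b))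
    (Eventually.of_forall fun ω => le_max_left _ _) hZb
    (fun t _ => Real.continuous_exp.intervalIntegrable 0 t)
    (Eventually.of_forall fun t => (Real.exp_pos t).le)
  have hmeas : ∀ w ∈ Set.Ioi (0 : ℝ),
      P {ω | w < max 0 (min (Z ω) b)} * ENNReal.ofReal (Real.exp w) =
        (Set.Iio b).indicator
          (fun w => ENNReal.ofReal (P.real {ω | w < Z ω} * Real.exp w)) w := by
    intro w (hw : 0 < w)
    by_cases hwb : w < b
    · simp [hw.not_gt, hwb, ENNReal.ofReal_mul]
    · simp [hw.not_gt, hwb]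
  have hanti : Antitone fun w => P.real {ω | w < Z ω} :=
    fun _ _ h => measureReal_mono fun _ hω => lt_of_le_of_lt h hω
  have hint : Integrable (fun ω => Real.exp (max 0 (min (Z ω) b))) P :=
    Integrable.of_mem_Icc 0 (Real.exp b) (Real.measurable_exp.comp_aemeasurable hZb)
      (Eventually.of_forall fun ω =>
        ⟨(Real.exp_pos _).le, Real.exp_le_exp.2 (max_le hb (min_le_right _ _))⟩)
  have hsub : ∫ ω, (Real.exp (max 0 (min (Z ω) b)) - 1) ∂P =
      ∫ w in (0 : ℝ)..b, P.real {ω | w < Z ω} * Real.exp w := by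
    rw [setLIntegral_congr_fun measurableSet_Ioi hmeas, lintegral_indicator measurableSet_Iio,
      Measure.restrict_restrict measurableSet_Iio, Set.inter_comm, Set.Ioi_inter_Iio] at hlayer
    simp only [integral_exp, Real.exp_zero] at hlayer
    rw [integral_eq_lintegral_of_nonneg_ae
        (Eventually.of_forall fun ω => sub_nonneg.2 (Real.one_le_exp (le_max_left _ _)))
        (hint.sub (integrable_const 1)).aestronglyMeasurable, hlayer,
      intervalIntegral.integral_of_le hb, integral_Ioc_eq_integral_Ioo,
      integral_eq_lintegral_of_nonneg_ae
        (Eventually.of_forall fun w => mul_nonneg measureReal_nonneg (Real.exp_pos w).le)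
        (Measurable.mul hanti.measurable Real.measurable_exp).aestronglyMeasurable]
  rw [← hsub, integral_sub hint (integrable_const 1)]
  simp

lemma integrable_truncatedRatio {Y : Ω → ℝ} (hY : AEMeasurable Y P) {t : ℝ} (ht : 0 < t)
    (ht1 : t ≤ 1) : Integrable (fun ω => truncatedRatio t (Y ω)) P :=
  Integrable.of_mem_Icc 0 1 (by unfold truncatedRatio; fun_prop)
    (Eventually.of_forall fun _ => truncatedRatio_mem_Icc ht ht1 _)

lemma HasLogTail.integral_truncatedRatio {Y : Ω → ℝ} (hY : AEMeasurable Y P) {m : ℕ} {C : ℝ}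
    (h : HasLogTail (fun t => P.real {ω | Y ω < t}) m C) :
    HasLogTail (fun t => ∫ ω, truncatedRatio t (Y ω) ∂P) (m + 1) (C / (m + 1)) := by
  have hpos := ae_pos_of_hasLogTail h
  set f : ℝ → ℝ := fun w => P.real {ω | Y ω < Real.exp (-w)} * Real.exp w with hf
  have hlim : Tendsto (fun w => f w / w ^ m) atTop (𝓝 C) := by
    refine (Tendsto.comp h
      (Real.tendsto_exp_atBot_nhdsGT.comp tendsto_neg_atTop_atBot)).congr fun w => ?_
    simp only [Function.comp_apply, Real.log_exp, neg_neg, hf, div_mul_eq_div_div]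
    rw [Real.exp_neg w, div_inv_eq_mul]
  have hint (b : ℝ) : IntervalIntegrable f volume 0 b := by
    have hanti : Antitone fun w => P.real {ω | Y ω < Real.exp (-w)} :=
      fun _ _ huv => monotone_measureReal_lt Y (Real.exp_le_exp.2 (neg_le_neg huv))
    exact hanti.intervalIntegrable.mul_continuousOn Real.continuous_exp.continuousOn
  have htail := (tendsto_intervalIntegral_div_pow_succ hint hlim).comp tendsto_neg_log_nhdsGT_zero
  have hone : Tendsto (fun t => P.real Set.univ / (-Real.log t) ^ (m + 1)) (𝓝[>] 0) (𝓝 0) :=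
    ((tendsto_pow_atTop m.succ_ne_zero).comp tendsto_neg_log_nhdsGT_zero).const_div_atTop _
  have hsum := hone.add htail
  rw [zero_add] at hsum
  refine Tendsto.congr' ?_ hsum
  filter_upwards [Ioo_mem_nhdsGT zero_lt_one] with t ⟨ht, ht1⟩
  have hlog : 0 < -Real.log t := neg_pos.2 (Real.log_neg ht ht1)
  have heq : ∫ ω, truncatedRatio t (Y ω) ∂P =
      t * (P.real Set.univ + ∫ w in (0 : ℝ)..-Real.log t, f w) := by
    have hlt (w : ℝ) : P.real {ω | w < -Real.log (Y ω)} = P.real {ω | Y ω < Real.exp (-w)} := by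
      refine measureReal_congr (eventuallyEq_set.2 (hpos.mono fun ω hω => ?_))
      rw [Set.mem_ofPred, Set.mem_ofPred, lt_neg, Real.log_lt_iff_lt_exp hω]
    rw [integral_congr_ae (hpos.mono fun ω hω => truncatedRatio_eq_mul_exp ht hω),
      integral_const_mul, integral_exp_max_zero_min
        (Z := fun ω => -Real.log (Y ω)) hY.log.neg hlog.le]
    simp only [hlt, hf]
  rw [heq, Function.comp_apply, mul_div_mul_left _ _ ht.ne', add_div]

end IsFiniteMeasure

variable [IsProbabilityMeasure P]

lemma measureReal_mul_lt {X Y : Ω → ℝ} (hX : AEMeasurable X P) (hY : AEMeasurable Y P)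
    (hXY : IndepFun X Y P) (hpos : ∀ᵐ ω ∂P, 0 < Y ω) (t : ℝ) :
    P.real {ω | X ω * Y ω < t} = ∫ ω, P.real {ω' | X ω' < t / Y ω} ∂P := by
  have := Measure.isProbabilityMeasure_map hX
  have := Measure.isProbabilityMeasure_map hY
  have hS : MeasurableSet {p : ℝ × ℝ | p.2 * p.1 < t} :=
    measurableSet_lt (measurable_snd.mul measurable_fst) measurable_const
  have hprod : P {ω | X ω * Y ω < t} =
      ∫⁻ y, (P.map X) (Prod.mk y ⁻¹' {p : ℝ × ℝ | p.2 * p.1 < t}) ∂P.map Y := by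
    rw [← Measure.prod_apply hS, ← hXY.symm.map_prod_eq_prod_map_map hY hX,
      Measure.map_apply_of_aemeasurable (hY.prodMk hX) hS]
    rfl
  rw [Measure.real, hprod, ← integral_toReal (measurable_measure_prodMk_left hS).aemeasurable
    (Eventually.of_forall fun _ => measure_lt_top _ _),
    integral_map hY (measurable_measure_prodMk_left hS).ennreal_toReal.aestronglyMeasurable]
  refine integral_congr_ae (hpos.mono fun ω hω => ?_)
  have hsection : Prod.mk (Y ω) ⁻¹' {p : ℝ × ℝ | p.2 * p.1 < t} = Set.Iio (t / Y ω) := by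
    ext x
    simp only [Set.mem_preimage, Set.mem_ofPred, Set.mem_Iio, lt_div_iff₀ hω]
  simp only [hsection, Measure.map_apply_of_aemeasurable hX measurableSet_Iio]
  rfl

lemma measureReal_mul_lt_sandwich {X Y : Ω → ℝ} (hX : AEMeasurable X P) (hY : AEMeasurable Y P)
    (hXY : IndepFun X Y P) (hpos : ∀ᵐ ω ∂P, 0 < Y ω) {c ε δ t : ℝ} (hc : 0 ≤ c) (hε : 0 ≤ ε)
    (hδ : 0 < δ) (hδ1 : δ ≤ 1)
    (hlin : ∀ s ∈ Set.Ioo 0 δ, |P.real {ω | X ω < s} / s - c| ≤ ε) (ht : 0 < t) (ht1 : t ≤ 1) :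
    (c - ε) * ∫ ω, truncatedRatio t (Y ω) ∂P - c * t - c * P.real {ω | Y ω < 2 / δ * t} ≤
        P.real {ω | X ω * Y ω < t} ∧
      P.real {ω | X ω * Y ω < t} ≤
        (c + ε) * ∫ ω, truncatedRatio t (Y ω) ∂P + P.real {ω | Y ω < 2 / δ * t} := by
  have hint : Integrable (fun ω => truncatedRatio t (Y ω)) P :=
    integrable_truncatedRatio hY ht ht1
  have hind := integrable_indicator_Iio hY (2 / δ * t)
  have hcdf : Integrable (fun ω => P.real {ω' | X ω' < t / Y ω}) P :=
    Integrable.of_mem_Icc 0 1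
      ((monotone_measureReal_lt X).measurable.comp_aemeasurable (hY.const_div t))
      (Eventually.of_forall fun ω => ⟨measureReal_nonneg, measureReal_le_one⟩)
  have hbound := hpos.mono fun ω hω => truncatedRatio_sandwich
    (fun s => ⟨measureReal_nonneg, measureReal_le_one⟩) hc hε hδ hδ1 hlin ht ht1 hω
  rw [measureReal_mul_lt hX hY hXY hpos]
  constructor
  · have hlow := integral_mono_ae (((hint.const_mul (c - ε)).sub (integrable_const (c * t))).sub
      (hind.const_mul c)) hcdf (hbound.mono fun ω hω => hω.1)
    rwa [integral_sub' ((hint.const_mul _).sub (integrable_const _)) (hind.const_mul c),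
      integral_sub' (hint.const_mul _) (integrable_const _), integral_const (c * t),
      integral_const_mul, integral_const_mul, integral_indicator_Iio hY, probReal_univ,
      one_smul] at hlow
  · have hup := integral_mono_ae hcdf ((hint.const_mul (c + ε)).add hind)
      (hbound.mono fun ω hω => hω.2)
    rwa [integral_add' (hint.const_mul _) hind, integral_const_mul, integral_indicator_Iio hY]
      at hup

lemma HasLogTail.measureReal_mul {X Y : Ω → ℝ} (hX : AEMeasurable X P) (hY : AEMeasurable Y P)
    (hXY : IndepFun X Y P) {m : ℕ} {c C : ℝ}
    (hXtail : HasLogTail (fun t => P.real {ω | X ω < t}) 0 c)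
    (hYtail : HasLogTail (fun t => P.real {ω | Y ω < t}) m C) :
    HasLogTail (fun t => P.real {ω | X ω * Y ω < t}) (m + 1) (c * (C / (m + 1))) := by
  have hslope : Tendsto (fun s => P.real {ω | X ω < s} / s) (𝓝[>] 0) (𝓝 c) := by
    simpa only [HasLogTail, pow_zero, mul_one] using hXtail
  have hc : 0 ≤ c := by
    refine ge_of_tendsto hslope ?_
    filter_upwards [self_mem_nhdsWithin] with s (hs : 0 < s)
      using div_nonneg measureReal_nonneg hs.le
  have hG := hYtail.integral_truncatedRatio hY
  have hid := (HasLogTail.self.lower_order m.succ_pos).const_mul c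
  refine .of_forall_squeeze (a := fun ε => (c - ε) * (C / (m + 1)))
    (b := fun ε => (c + ε) * (C / (m + 1))) ?_ ?_ ?_
  · exact ((by fun_prop : Continuous fun ε => (c - ε) * (C / (m + 1))).tendsto' 0 _
      (by simp)).mono_left nhdsWithin_le_nhds
  · exact ((by fun_prop : Continuous fun ε => (c + ε) * (C / (m + 1))).tendsto' 0 _
      (by simp)).mono_left nhdsWithin_le_nhds
  filter_upwards [self_mem_nhdsWithin] with ε (hε : 0 < ε)
  have hclose : ∀ᶠ s in 𝓝[>] 0, |P.real {ω | X ω < s} / s - c| ≤ ε := by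
    have h := (hslope.sub_const c).abs
    rw [sub_self, abs_zero] at h
    exact h.eventually_le_const hε
  obtain ⟨δ, ⟨hδ, hδ1⟩, hlin⟩ := (mem_nhdsGT_iff_exists_mem_Ioc_Ioo_subset zero_lt_one).1 hclose
  have hnear := (hYtail.lower_order m.lt_succ_self).comp_const_mul (div_pos two_pos hδ)
  have hsandwich := (eventually_mem_set.2 (Ioo_mem_nhdsGT zero_lt_one)).mono fun t ht =>
    measureReal_mul_lt_sandwich hX hY hXY (ae_pos_of_hasLogTail hYtail) hc hε.le hδ hδ1 hlin
      ht.1 ht.2.le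
  refine ⟨_, _, ?_, ?_, hsandwich⟩
  · simpa [sub_eq_add_neg] using
      ((hG.const_mul (c - ε)).add (hid.const_mul (-1))).add (hnear.const_mul (-c))
  · simpa using (hG.const_mul (c + ε)).add hnear

lemma hasLogTail_prod {ι : Type*} {X : ι → Ω → ℝ} {c : ι → ℝ} (hX : ∀ i, AEMeasurable (X i) P)
    (hindep : iIndepFun X P) (htail : ∀ i, HasLogTail (fun t => P.real {ω | X i ω < t}) 0 (c i))
    {s : Finset ι} (hs : s.Nonempty) {m : ℕ} (hm : s.card = m + 1) :
    HasLogTail (fun t => P.real {ω | ∏ i ∈ s, X i ω < t}) m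
      ((∏ i ∈ s, c i) / (m.factorial : ℝ)) := by
  induction hs using Finset.Nonempty.cons_induction generalizing m with
  | singleton a =>
    obtain rfl : m = 0 := by simpa using hm.symm
    simpa using htail a
  | cons a s ha hs ih =>
    rw [Finset.card_cons, Nat.add_right_cancel_iff] at hm
    obtain ⟨k, rfl⟩ := Nat.exists_eq_add_one.2 (hm ▸ hs.card_pos)
    have hind : IndepFun (X a) (fun ω => ∏ i ∈ s, X i ω) P := by
      simpa only [Finset.prod_fn] using (hindep.indepFun_finsetProd_of_notMem₀ hX ha).symm
    have h := (htail a).measureReal_mul (hX a) (Finset.aemeasurable_fun_prod s fun i _ => hX i)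
      hind (ih hm)
    have hconst : (∏ i ∈ s.cons a ha, c i) / ((k + 1).factorial : ℝ) =
        c a * ((∏ i ∈ s, c i) / k.factorial / (k + 1)) := by
      rw [Finset.prod_cons, Nat.factorial_succ, Nat.cast_mul, Nat.cast_succ]
      field_simp
    rw [hconst]
    simpa only [Finset.prod_cons] using h

end LowerTail

section Outage

variable {Ω : Type*} {M : ℕ}

lemma snr_lt_iff {A ρ : Fin (M + 1) → ℝ} {h : Fin (M + 1) → Ω → ℂ} {γ γth : ℝ} {ω : Ω}
    (hρ : ∀ n, 0 < ρ n) (hpos : ∀ n, 0 < hopPower A h n ω) (hγth : 0 < γth) :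
    snr A ρ h γ ω < γth ↔
      (γth * γ⁻¹)⁻¹ < ∑ n, ρ n / ∏ j ∈ Finset.Iic n, hopPower A h j ω := by
  have hprod (s : Finset (Fin (M + 1))) : 0 < ∏ j ∈ s, hopPower A h j ω :=
    Finset.prod_pos fun j _ => hpos j
  have hden : 0 < ∑ n, ρ n * ∏ j ∈ Finset.Ioi n, hopPower A h j ω :=
    Finset.sum_pos (fun n _ => mul_pos (hρ n) (hprod _)) Finset.univ_nonempty
  have hsum : ∑ n, ρ n / ∏ j ∈ Finset.Iic n, hopPower A h j ω =
      (∑ n, ρ n * ∏ j ∈ Finset.Ioi n, hopPower A h j ω) / ∏ n, hopPower A h n ω := by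
    rw [Finset.sum_div]
    refine Finset.sum_congr rfl fun n _ => ?_
    rw [div_eq_div_iff (hprod _).ne' (hprod _).ne', mul_assoc, ← Finset.prod_union]
    · congr 2
      ext j
      simpa using (lt_or_ge n j)
    · exact Finset.disjoint_left.2 fun j hj hj' =>
        (Finset.mem_Ioi.1 hj).not_ge (Finset.mem_Iic.1 hj')
  rw [hsum, snr, div_mul_eq_mul_div, div_lt_iff₀ hden, lt_div_iff₀ (hprod _), mul_inv, inv_inv,
    inv_mul_eq_div, div_mul_eq_mul_div, div_lt_iff₀ hγth, mul_comm γ, mul_comm γth]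

variable [MeasurableSpace Ω] {P : Measure Ω} [IsProbabilityMeasure P]

lemma hasLogTail_sum_div_prod {X : Fin (M + 1) → Ω → ℝ} {ρ c : Fin (M + 1) → ℝ}
    (hρ : ∀ n, 0 < ρ n) (hX : ∀ n, AEMeasurable (X n) P) (hindep : iIndepFun X P)
    (htail : ∀ n, HasLogTail (fun t => P.real {ω | X n ω < t}) 0 (c n)) :
    HasLogTail (fun t => P.real {ω | t⁻¹ < ∑ n, ρ n / ∏ j ∈ Finset.Iic n, X j ω}) M
      (ρ (Fin.last M) * ((∏ n, c n) / M.factorial)) := by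
  have hpos : ∀ᵐ ω ∂P, ∀ n, 0 < X n ω := ae_all_iff.2 fun n => ae_pos_of_hasLogTail (htail n)
  have hterm (n : Fin (M + 1)) :
      HasLogTail (fun t => P.real {ω | t⁻¹ < ρ n / ∏ j ∈ Finset.Iic n, X j ω}) n
        (ρ n * ((∏ j ∈ Finset.Iic n, c j) / n.val.factorial)) := by
    refine ((hasLogTail_prod hX hindep htail Finset.nonempty_Iic
      (Fin.card_Iic n)).comp_const_mul (hρ n)).congr ?_
    filter_upwards [self_mem_nhdsWithin] with t (ht : 0 < t)
    refine measureReal_congr (eventuallyEq_set.2 (hpos.mono fun ω hω => ?_))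
    rw [Set.mem_ofPred, Set.mem_ofPred, lt_div_iff₀ (Finset.prod_pos fun j _ => hω j),
      inv_mul_lt_iff₀ ht, mul_comm]
  have hrest := hasLogTail_measureReal_lt_sum Finset.univ
    (fun n : Fin M => hpos.mono fun ω hω =>
      div_nonneg (hρ n.castSucc).le (Finset.prod_nonneg fun j _ => (hω j).le))
    (fun n => (hterm n.castSucc).lower_order n.isLt)
  have huniv : Finset.Iic (Fin.last M) = Finset.univ :=
    Finset.eq_univ_iff_forall.2 fun j => Finset.mem_Iic.2 (Fin.le_last j)
  have hlast := hterm (Fin.last M)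
  simp only [huniv, Fin.val_last] at hlast
  simpa only [Fin.sum_univ_castSucc, huniv, add_comm] using hlast.measureReal_lt_add
    (hpos.mono fun ω hω => Finset.sum_nonneg fun n _ =>
      div_nonneg (hρ _).le (Finset.prod_nonneg fun j _ => (hω j).le)) hrest

lemma tendsto_outage_div {A ρ c : Fin (M + 1) → ℝ} {h : Fin (M + 1) → Ω → ℂ} {γth : ℝ}
    (hρ : ∀ n, 0 < ρ n) (hγth : 0 < γth) (hmeas : ∀ n, AEMeasurable (hopPower A h n) P)
    (hindep : iIndepFun (fun n => hopPower A h n) P)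
    (htail : ∀ n, HasLogTail (fun t => P.real {ω | hopPower A h n ω < t}) 0 (c n)) :
    Tendsto (fun γ => outage P A ρ h γth γ / (Real.log γ ^ M / γ)) atTop
      (𝓝 (ρ (Fin.last M) * γth / M.factorial * ∏ n, c n)) := by
  have hpos : ∀ᵐ ω ∂P, ∀ n, 0 < hopPower A h n ω :=
    ae_all_iff.2 fun n => ae_pos_of_hasLogTail (htail n)
  have hlim := ((hasLogTail_sum_div_prod hρ hmeas hindep htail).comp_const_mul hγth).tendsto_atTop
  have hout (γ : ℝ) : outage P A ρ h γth γ = P.real {ω | (γth * γ⁻¹)⁻¹ <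
      ∑ n, ρ n / ∏ j ∈ Finset.Iic n, hopPower A h j ω} :=
    measureReal_congr (eventuallyEq_set.2 (hpos.mono fun ω hω => snr_lt_iff hρ hω hγth))
  convert hlim using 2
  · rw [hout]
  · ring

end Outage

section HoytLaw

lemma continuous_besselI0 : Continuous besselI0 := by
  rw [continuous_iff_continuousAt]
  intro x
  have h : ContinuousOn besselI0 (Metric.ball 0 (|x| + 1)) := by
    refine continuousOn_tsum (fun k => by fun_prop)
      (Real.summable_pow_div_factorial (((|x| + 1) / 2) ^ 2)) fun k y hy => ?_
    have hy' : |y| ≤ |x| + 1 := by simpa using (Metric.mem_ball.1 hy).le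
    have hk : (1 : ℝ) ≤ k.factorial := Nat.one_le_cast.2 k.factorial_pos
    rw [norm_div, norm_pow, norm_pow, Real.norm_natCast, ← pow_mul, Real.norm_eq_abs, abs_div,
      abs_two]
    gcongr
    exact le_self_pow₀ hk two_ne_zero
  exact h.continuousAt (Metric.isOpen_ball.mem_nhds (by simp [Metric.mem_ball]))

lemma besselI0_zero : besselI0 0 = 1 := by
  refine (tsum_eq_single 0 fun k hk => ?_).trans (by simp)
  simp [hk]

lemma besselI0_nonneg (x : ℝ) : 0 ≤ besselI0 x :=
  tsum_nonneg fun k => div_nonneg (by rw [pow_mul]; positivity) (by positivity)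

lemma withDensity_real_Iio {g : ℝ → ℝ} (hg : Continuous g) (hg0 : ∀ x, 0 ≤ x → 0 ≤ g x) {t : ℝ}
    (ht : 0 ≤ t) :
    (volume.withDensity fun x => ENNReal.ofReal (if 0 ≤ x then g x else 0)).real (Set.Iio t) =
      ∫ x in (0 : ℝ)..t, g x := by
  have hind : (fun x => ENNReal.ofReal (if 0 ≤ x then g x else 0)) =
      (Set.Ici 0).indicator fun x => ENNReal.ofReal (g x) := by
    ext x
    by_cases hx : 0 ≤ x <;> simp [hx]
  rw [Measure.real, withDensity_apply _ measurableSet_Iio, hind,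
    lintegral_indicator measurableSet_Ici, Measure.restrict_restrict measurableSet_Ici,
    Set.Ici_inter_Iio, intervalIntegral.integral_of_le ht, integral_Ioc_eq_integral_Ioo,
    ← integral_Ico_eq_integral_Ioo,
    integral_eq_lintegral_of_nonneg_ae _ hg.aestronglyMeasurable]
  exact (ae_restrict_mem measurableSet_Ico).mono fun x hx => hg0 x hx.1

lemma hasLogTail_withDensity {g : ℝ → ℝ} (hg : Continuous g) (hg0 : ∀ x, 0 ≤ x → 0 ≤ g x) :
    HasLogTail
      (fun t => (volume.withDensity fun x => ENNReal.ofReal (if 0 ≤ x then g x else 0)).real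
        (Set.Iio t)) 0 (g 0) := by
  have hderiv := (hg.integral_hasStrictDerivAt 0 0).hasDerivAt.tendsto_slope_zero_right
  refine hderiv.congr' ?_
  filter_upwards [self_mem_nhdsWithin] with t (ht : 0 < t)
  rw [withDensity_real_Iio hg hg0 ht.le, zero_add, intervalIntegral.integral_same, sub_zero,
    smul_eq_mul, pow_zero, mul_one, inv_mul_eq_div]

lemma hasLogTail_hoyt {Ω : Type*} [MeasurableSpace Ω] {P : Measure Ω} {X : Ω → ℝ} {q θ : ℝ}
    (hq : 0 < q) (hθ : 0 < θ) (hX : HasLaw X (hoytMeasure q θ) P) :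
    HasLogTail (fun t => P.real {ω | X ω < t}) 0 ((1 + q ^ 2) / (2 * q * θ)) := by
  set g : ℝ → ℝ := fun x => (1 + q ^ 2) / (2 * q * θ) *
    Real.exp (-((1 + q ^ 2) ^ 2 / (4 * q ^ 2 * θ) * x)) *
      besselI0 ((1 - q ^ 4) / (4 * q ^ 2 * θ) * x) with hg
  have hgc : Continuous g := by
    have := continuous_besselI0
    fun_prop
  have hg0 (x : ℝ) : 0 ≤ g x := mul_nonneg (by positivity) (besselI0_nonneg _)
  have hgzero : g 0 = (1 + q ^ 2) / (2 * q * θ) := by simp [hg, besselI0_zero]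
  have hcdf (t : ℝ) : P.real {ω | X ω < t} = (hoytMeasure q θ).real (Set.Iio t) := by
    rw [← hX.map_eq, map_measureReal_apply_of_aemeasurable hX.aemeasurable measurableSet_Iio]
    rfl
  simp only [hcdf, ← hgzero]
  exact hasLogTail_withDensity hgc fun x _ => hg0 x

end HoytLaw

section Leading

variable {M : ℕ} {ρ q θ : Fin (M + 1) → ℝ} {γth : ℝ}

lemma indexSet_last {L : Fin M → ℕ} (hL : ∀ k, 1 ≤ L k) : indexSet L (M + 1) = {0} := by
  ext ℓ
  simp only [indexSet, Finset.mem_filter, Fintype.mem_piFinset, Finset.mem_range,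
    Nat.add_sub_cancel, Finset.mem_singleton]
  constructor
  · rintro ⟨-, h, -⟩
    funext k
    exact (Finset.sum_eq_zero_iff.1 h) k (by simp)
  · rintro rfl
    exact ⟨fun k => hL k, lam_zero M, fun h => absurd h (by omega)⟩

lemma scale_mul_chi_zero (hq : ∀ n, 0 < q n) (hθ : ∀ n, 0 < θ n) :
    scale ρ q θ γth * chi ρ q θ 0 =
      ρ (Fin.last M) * γth * ∏ n, (1 + q n ^ 2) / (2 * q n * θ n) := by
  have hchi : chi ρ q θ 0 = ∏ n, 2 * q n / (1 + q n ^ 2) := by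
    simp only [chi, lam_zero, Fin.prod_univ_castSucc, Pi.zero_apply, pow_zero, mul_zero, add_zero,
      pow_one, Nat.factorial_zero, Nat.cast_one, div_one, one_mul]
    ring
  rw [hchi, scale, mul_div_assoc, mul_assoc (ρ (Fin.last M) * γth), ← Finset.prod_div_distrib,
    ← Finset.prod_mul_distrib]
  congr 1
  refine Finset.prod_congr rfl fun n _ => ?_
  have := (hq n).ne'
  have := (hθ n).ne'
  have : 1 + q n ^ 2 ≠ 0 := by positivity
  field_simp
  ring

lemma tendsto_sub_log_pow_div (b : ℝ) {l : ℕ} (hl : l ≤ M) :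
    Tendsto (fun γ => (b - Real.log γ) ^ l / γ / (Real.log γ ^ M / γ)) atTop
      (𝓝 (if l = M then (-1) ^ M else 0)) := by
  have hratio : Tendsto (fun γ => (b - Real.log γ) / Real.log γ) atTop (𝓝 (-1)) := by
    have h := (Real.tendsto_log_atTop.const_div_atTop b).sub_const 1
    rw [zero_sub] at h
    refine h.congr' ?_
    filter_upwards [eventually_gt_atTop 1] with γ hγ
    rw [sub_div, div_self (Real.log_pos hγ).ne']
  have hgap : Tendsto (fun γ => ((Real.log γ)⁻¹) ^ (M - l)) atTop
      (𝓝 (if l = M then 1 else 0)) := by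
    split_ifs with h
    · simp [h]
    · have := (tendsto_inv_atTop_zero.comp Real.tendsto_log_atTop).pow (M - l)
      rwa [zero_pow (Nat.sub_ne_zero_of_lt (lt_of_le_of_ne hl h))] at this
  have hlim := (hratio.pow l).mul hgap
  have hval : (-1 : ℝ) ^ l * (if l = M then 1 else 0) = if l = M then (-1) ^ M else 0 := by
    split_ifs with h <;> simp [h]
  rw [hval] at hlim
  refine hlim.congr' ?_
  filter_upwards [eventually_gt_atTop 1] with γ hγ
  rw [div_div_div_cancel_right₀ (zero_lt_one.trans hγ).ne', div_pow, inv_pow, ← div_eq_mul_inv,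
    div_div, ← pow_add, Nat.add_sub_cancel' hl]

lemma sum_choose_mul_log_pow_div (b γ : ℝ) (l : ℕ) :
    ∑ p ∈ Finset.range (l + 1),
      (l.choose p : ℝ) * (-1) ^ p * b ^ (l - p) * (Real.log γ ^ p / γ) =
        (b - Real.log γ) ^ l / γ := by
  rw [sub_eq_neg_add, add_pow, Finset.sum_div]
  refine Finset.sum_congr rfl fun p _ => ?_
  rw [neg_pow]
  ring

lemma tendsto_expansion_div (hq : ∀ n, 0 < q n) (hθ : ∀ n, 0 < θ n)
    {L : Fin M → ℕ} (hL : ∀ k, 1 ≤ L k) :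
    Tendsto (fun γ => expansion ρ q θ γth L γ / (Real.log γ ^ M / γ)) atTop
      (𝓝 (ρ (Fin.last M) * γth / (M.factorial : ℝ) *
        ∏ n, (1 + q n ^ 2) / (2 * q n * θ n))) := by
  have hlim : Tendsto (fun γ => expansion ρ q θ γth L γ / (Real.log γ ^ M / γ)) atTop
      (𝓝 (scale ρ q θ γth *
        ∑ r ∈ Finset.Icc 1 (M + 1), ∑ ℓ ∈ indexSet L r,
          (-1) ^ lam ℓ M * chi ρ q θ ℓ *
            ∑ l ∈ Finset.range r,
              etaDeriv q ℓ r (r - 1 - l) / (((r - 1 - l).factorial : ℝ) * (l.factorial : ℝ)) *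
                (if l = M then (-1) ^ M else 0))) := by
    simp only [expansion, sum_choose_mul_log_pow_div, mul_div_assoc, Finset.sum_div]
    refine Tendsto.const_mul _ (tendsto_finsetSum _ fun r hr => tendsto_finsetSum _ fun ℓ _ =>
      Tendsto.const_mul _ (tendsto_finsetSum _ fun l hl => Tendsto.const_mul _
        (tendsto_sub_log_pow_div _ ?_)))
    rw [Finset.mem_Icc] at hr
    rw [Finset.mem_range] at hl
    omega
  have hsmall : ∀ r ∈ Finset.Icc 1 (M + 1), r ≠ M + 1 → ∀ l ∈ Finset.range r, l ≠ M := by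
    intro r hr hrM l hl
    rw [Finset.mem_Icc] at hr
    rw [Finset.mem_range] at hl
    omega
  convert hlim using 2
  rw [Finset.sum_eq_single_of_mem (M + 1) (by simp), indexSet_last hL, Finset.sum_singleton,
    Finset.sum_eq_single_of_mem M (by simp)]
  · have hsign : ((-1 : ℝ) ^ M) * (-1) ^ M = 1 := by rw [← mul_pow]; simp
    simp only [lam_zero, pow_zero, one_mul, Nat.add_sub_cancel, Nat.sub_self, etaDeriv_zero hq,
      Nat.factorial_zero, Nat.cast_one, if_true]
    rw [div_mul_eq_mul_div ((-1 : ℝ) ^ M), hsign, ← mul_assoc (scale ρ q θ γth),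
      scale_mul_chi_zero hq hθ]
    ring
  · intro l _ hlM
    rw [if_neg hlM, mul_zero]
  · intro r hr hrM
    refine Finset.sum_eq_zero fun ℓ _ => mul_eq_zero_of_right _ (Finset.sum_eq_zero fun l hl => ?_)
    rw [if_neg (hsmall r hr hrM l hl), mul_zero]

lemma isEquivalent_leading_of_tendsto {u : ℝ → ℝ} (hρ : ∀ n, 0 < ρ n) (hq : ∀ n, 0 < q n)
    (hθ : ∀ n, 0 < θ n) (hγth : 0 < γth)
    (hu : Tendsto (fun γ => u γ / (Real.log γ ^ M / γ)) atTop
      (𝓝 (ρ (Fin.last M) * γth / (M.factorial : ℝ) *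
        ∏ n, (1 + q n ^ 2) / (2 * q n * θ n)))) :
    u ~[atTop] leading ρ q θ γth := by
  set K := ρ (Fin.last M) * γth / (M.factorial : ℝ) *
        ∏ n, (1 + q n ^ 2) / (2 * q n * θ n) with hK
  have hK0 : K ≠ 0 := by
    have := hρ (Fin.last M)
    refine mul_ne_zero (by positivity) (Finset.prod_ne_zero_iff.2 fun n _ => ?_)
    have := hq n
    have := hθ n
    positivity
  refine isEquivalent_of_tendsto_one ?_
  have h := hu.div_const K
  rw [div_self hK0] at h
  refine h.congr fun γ => ?_
  rw [Pi.div_apply, leading, ← hK, div_div, mul_comm K]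

end Leading

end HoytRelay

theorem mainTheorem6 {Ω : Type*} [MeasurableSpace Ω] (P : Measure Ω) [IsProbabilityMeasure P]
    (M : ℕ) (hM : 1 ≤ M)
    (A ρ q θ : Fin (M + 1) → ℝ) (γth : ℝ) (h : Fin (M + 1) → Ω → ℂ)
    (hρ : ∀ n, 0 < ρ n) (hq : ∀ n, 0 < q n) (hθ : ∀ n, 0 < θ n) (hγth : 0 < γth)
    (hlaw : ∀ n, HasLaw (HoytRelay.hopPower A h n) (HoytRelay.hoytMeasure (q n) (θ n)) P)
    (hindep : iIndepFun (fun n => HoytRelay.hopPower A h n) P)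
    (L : Fin M → ℕ) (hL : ∀ k, 1 ≤ L k) :
    (∀ r ∈ Finset.Icc 1 (M + 1), ∀ ℓ ∈ HoytRelay.indexSet L r, ∀ k < r,
      Tendsto (iteratedDeriv k (HoytRelay.eta q ℓ r)) (𝓝[≠] (1 : ℝ))
        (𝓝 (HoytRelay.etaDeriv q ℓ r k))) ∧
    (fun γ : ℝ => HoytRelay.outage P A ρ h γth γ) ~[atTop]
      (fun γ : ℝ => HoytRelay.expansion ρ q θ γth L γ) ∧
    (fun γ : ℝ => HoytRelay.outage P A ρ h γth γ) ~[atTop]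
      (fun γ : ℝ => HoytRelay.leading ρ q θ γth γ) := by
  have hlead := HoytRelay.isEquivalent_leading_of_tendsto hρ hq hθ hγth
    (HoytRelay.tendsto_outage_div hρ hγth (fun n => (hlaw n).aemeasurable) hindep
      fun n => HoytRelay.hasLogTail_hoyt (hq n) (hθ n) (hlaw n))
  have hexp := HoytRelay.isEquivalent_leading_of_tendsto hρ hq hθ hγth
    (HoytRelay.tendsto_expansion_div hq hθ hL)
  exact ⟨fun r hr ℓ hℓ k _ => HoytRelay.tendsto_iteratedDeriv_eta hq hr hℓ k,
    hlead.trans hexp.symm, hlead⟩
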